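/- Let $\mathcal{M}_1(\mathbb{N})$ be the set of probability measures on $\mathbb{N}=\{0,1,2,\dots\}$ with the total variation metric $d$. Put $\vartheta(z)=z\log z$ (with $0\log 0=0$), $\langle\xi,\vartheta\rangle=\sum_z\xi(z)\vartheta(z)\in[0,\infty]$, $\mathscr{K}_M=\{\xi\in\mathcal{M}_1(\mathbb{N}):\langle\xi,\vartheta\rangle\le M\}$ for $M>0$, and $\mathscr{K}=\bigcup_{M\ge1}\mathscr{K}_M$. Let $$\mathcal{E}=\{(z,z+1):z\ge0\}\cup\{(z,0):z\ge1\},$$ and let $\lambda_{z,z'}:\mathcal{M}_1(\mathbb{N})\to\mathbb{R}_+$, $(z,z')\in\mathcal{E}$, be transition rates such that: (i) there are constants $\underline\lambda,\overline\lambda>0$ with $\frac{\underline\lambda}{z+1}\le\lambda_{z,z+1}(\xi)\le\frac{\overline\lambda}{z+1}$ for all $z\ge 0$ and $\underline\lambda\le\lambda_{z,0}(\xi)\le\overline\lambda$ for all $z\ge 1$, for every $\xi\in\mathcal{M}_1(\mathbb{N})$; (ii) the functions $(z+1)\lambda_{z,z+1}(\cdot)$, $z\ge0$, and $\lambda_{z,0}(\cdot)$,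 $z\ge1$, are Lipschitz on $(\mathcal{M}_1(\mathbb{N}),d)$ with a common Lipschitz constant. Let $\Lambda_\xi$ be the rate matrix with off-diagonal entries $\lambda_{z,z'}(\xi)$ for $(z,z')\in\mathcal{E}$ and $0$ for $(z,z')\notin\mathcal{E}$, and with zero row sums; let $\Lambda_\xi^*$ be its transpose. Let $\mu_\nu$ denote the solution on $[0,\infty)$ of the McKean–Vlasov equation $\dot\mu(t)=\Lambda^*_{\mu(t)}\mu(t)$, $\mu(0)=\nu$. Assume further that: (iii) $\xi^*\in\mathcal{M}_1(\mathbb{N})$ is a (necessarily unique) globally asymptotically stable equilibrium of this equation (an equilibrium that is Lyapunov stable and attracts every solution, with respect to $d$); (iv) $\langle\xi^*,\vartheta\rangle<\infty$, and $\lim_{t\to\infty}\sup_{\nu\in\mathscr{K}_M}\langle\mu_\nu(t),\vartheta\rangle=\langle\xi^*,\vartheta\rangle$ for each $M>0$. Let $\tau(u)=e^u-u-1$. For $T>0$, $\nu\in\mathcal{M}_1(\mathbb{N})$ and $\varphi:[0,T]\to\mathcal{M}_1(\mathbb{N})$ put $$S_{[0,T]}(\varphi|\nu)=\int_0^T\sup_{\alpha}\Big\{\langle\alpha,\dot\varphi_t-\Lambda^*_{\varphi_t}\varphi_t\rangle-\sum_{(z,z')\in\mathcal{E}}\tau(\alpha(z')-\alpha(z))\,\lambda_{z,z'}(\varphi_t)\,\varphi_t(z)\Big\}\,dt,$$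 where $\alpha$ ranges over the finitely supported functions $\mathbb{N}\to\mathbb{R}$ and $\langle \alpha, v\rangle=\sum_z\alpha(z)v(z)$, if $\varphi_0=\nu$ and $\varphi$ is absolutely continuous; put $S_{[0,T]}(\varphi|\nu)=\infty$ otherwise. Here $\varphi$ is called absolutely continuous if for each finite $K\subset\mathbb{N}$ there are $\varepsilon>0$ and an absolutely continuous $H:[0,T]\to\mathbb{R}$ with $|\langle f,\varphi_s\rangle-\langle f,\varphi_t\rangle|\le|H(s)-H(t)|$ for all $s,t\in[0,T]$ and all $f$ supported in $K$ with $|f|<\varepsilon$ (equivalently, $t\mapsto\varphi_t(z)$ is absolutely continuous for every $z$), and $\dot\varphi_t(z)=\frac{d}{dt}\varphi_t(z)$ for almost every $t$. Define the quasipotential $$V(\xi)=\inf\{S_{[0,T]}(\varphi|\xi^*):T>0,\ \varphi(0)=\xi^*,\ \varphi(T)=\xi\},\qquad \xi\in\mathcal{M}_1(\mathbb{N}).$$ Then, for every $\xi\in\mathcal{M}_1(\mathbb{N})$, $V(\xi)<\infty$ if and only if $\xi\in\mathscr{K}$, i.e. $\langle\xi,\vartheta\rangle<\infty$. Furthermore,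 for every $M>0$ there is a constant $C_M>0$ such that $V(\xi)\le C_M$ for all $\xi\in\mathscr{K}_M$. -/

import Mathlib

open Filter Topology MeasureTheory
open scoped ENNReal

noncomputable section

namespace MeanField

/-- The mass `ξ(z)` of a probability measure `ξ` on `ℕ`, as a real number. -/
def mass (ξ : PMF ℕ) (z : ℕ) : ℝ := (ξ z).toReal

/-- The total variation metric `d(ξ, ζ) = sup_B |ξ(B) - ζ(B)|` on probability measures on `ℕ`,
written as one half of the `ℓ¹` distance. -/
def tvDist (ξ ζ : PMF ℕ) : ℝ := (1 / 2) * ∑' z : ℕ, |mass ξ z - mass ζ z|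

/-- `ϑ(z) = z log z`, with `0 log 0 = 0`. -/
def vartheta (z : ℕ) : ℝ := (z : ℝ) * Real.log (z : ℝ)

/-- The moment `⟨ξ, ϑ⟩ ∈ [0, ∞]`. -/
def thetaMoment (ξ : PMF ℕ) : ℝ≥0∞ := ∑' z : ℕ, ξ z * ENNReal.ofReal (vartheta z)

/-- `𝒦_M = {ξ : ⟨ξ, ϑ⟩ ≤ M}`. -/
def KBall (M : ℝ) : Set (PMF ℕ) := {ξ | thetaMoment ξ ≤ ENNReal.ofReal M}

/-- `𝒦 = ⋃_{M ≥ 1} 𝒦_M`. -/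
def KSet : Set (PMF ℕ) := ⋃ M ∈ Set.Ici (1 : ℝ), KBall M

/-- `τ(u) = e^u - u - 1`. -/
def tau (u : ℝ) : ℝ := Real.exp u - u - 1

/-! Below, `E` is the edge set of a directed graph on `ℕ` and, for `(z, z') ∈ E`,
`lam z z' ξ` is the transition rate `λ_{z,z'}(ξ)`. The values of `lam` off `E` are never used. -/

open Classical in
/-- The rate matrix `Λ_ξ`: `Λ_ξ(z,z') = λ_{z,z'}(ξ)` on edges, `0` off the edges, and
`Λ_ξ(z,z) = - ∑_{z' ≠ z} λ_{z,z'}(ξ)`. -/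
def rateMatrix (E : Set (ℕ × ℕ)) (lam : ℕ → ℕ → PMF ℕ → ℝ) (ξ : PMF ℕ) (z z' : ℕ) : ℝ :=
  if z = z' then -∑' w : ℕ, (if (z, w) ∈ E ∧ w ≠ z then lam z w ξ else 0)
  else if (z, z') ∈ E then lam z z' ξ else 0

/-- The drift `(Λ_ξ^* ξ)(z) = ∑_{z'} Λ_ξ(z',z) ξ(z')`. -/
def drift (E : Set (ℕ × ℕ)) (lam : ℕ → ℕ → PMF ℕ → ℝ) (ξ : PMF ℕ) (z : ℕ) : ℝ :=
  ∑' z' : ℕ, rateMatrix E lam ξ z' z * mass ξ z'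

/-- `μ` (restricted to `[0, ∞)`) solves the McKean-Vlasov equation `μ'(t) = Λ_{μ(t)}^* μ(t)`. -/
def IsMVSolution (E : Set (ℕ × ℕ)) (lam : ℕ → ℕ → PMF ℕ → ℝ) (μ : ℝ → PMF ℕ) : Prop :=
  ∀ t : ℝ, 0 ≤ t → ∀ z : ℕ,
    HasDerivWithinAt (fun s => mass (μ s) z) (drift E lam (μ t) z) (Set.Ici 0) t

/-- `ξstar` is a globally asymptotically stable equilibrium of the McKean-Vlasov equation: it is
an equilibrium, it is (Lyapunov) stable, and every solution converges to it. (There is at most one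
such point, since every other equilibrium is a constant solution.) -/
structure IsGloballyAsymptoticallyStable (E : Set (ℕ × ℕ)) (lam : ℕ → ℕ → PMF ℕ → ℝ)
    (ξstar : PMF ℕ) : Prop where
  equilibrium : ∀ z : ℕ, drift E lam ξstar z = 0
  stable : ∀ ε : ℝ, 0 < ε → ∃ δ : ℝ, 0 < δ ∧ ∀ μ : ℝ → PMF ℕ, IsMVSolution E lam μ →
    tvDist (μ 0) ξstar < δ → ∀ t : ℝ, 0 ≤ t → tvDist (μ t) ξstar < ε
  attracting : ∀ μ : ℝ → PMF ℕ, IsMVSolution E lam μ →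
    Tendsto (fun t : ℝ => tvDist (μ t) ξstar) atTop (𝓝 0)

/-- The edge set `{(z,z+1) : z ≥ 0} ∪ {(z,0) : z ≥ 1}`. -/
def forwardResetEdges : Set (ℕ × ℕ) :=
  {e | ∃ z : ℕ, e = (z, z + 1)} ∪ {e | ∃ z : ℕ, z ≠ 0 ∧ e = (z, 0)}

/-- Two-sided bounds on the rates; the forward rates decay like `1 / (z + 1)`. -/
def RateBounds (lam : ℕ → ℕ → PMF ℕ → ℝ) : Prop :=
  ∃ lo hi : ℝ, 0 < lo ∧ 0 < hi ∧ ∀ ξ : PMF ℕ,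
    (∀ z : ℕ, lo / ((z : ℝ) + 1) ≤ lam z (z + 1) ξ ∧ lam z (z + 1) ξ ≤ hi / ((z : ℝ) + 1)) ∧
    (∀ z : ℕ, z ≠ 0 → lo ≤ lam z 0 ξ ∧ lam z 0 ξ ≤ hi)

/-- The functions `(z+1) λ_{z,z+1}`, `z ≥ 0`, and `λ_{z,0}`, `z ≥ 1`, are Lipschitz in total
variation, with a common constant. -/
def RateLipschitz (lam : ℕ → ℕ → PMF ℕ → ℝ) : Prop :=
  ∃ L : ℝ, ∀ ξ ζ : PMF ℕ,
    (∀ z : ℕ, |((z : ℝ) + 1) * lam z (z + 1) ξ - ((z : ℝ) + 1) * lam z (z + 1) ζ|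
      ≤ L * tvDist ξ ζ) ∧
    (∀ z : ℕ, z ≠ 0 → |lam z 0 ξ - lam z 0 ζ| ≤ L * tvDist ξ ζ)

/-- `⟨ξ*, ϑ⟩ < ∞`, and `sup_{ν ∈ 𝒦_M} ⟨μ_ν(t), ϑ⟩ → ⟨ξ*, ϑ⟩` as `t → ∞` for every `M > 0`, where
`μ_ν` is the solution of the McKean-Vlasov equation with `μ_ν(0) = ν`. -/
def ThetaMomentConvergence (E : Set (ℕ × ℕ)) (lam : ℕ → ℕ → PMF ℕ → ℝ) (ξstar : PMF ℕ) : Prop :=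
  thetaMoment ξstar < ⊤ ∧ ∀ M : ℝ, 0 < M →
    Tendsto (fun t : ℝ => ⨆ (μ : ℝ → PMF ℕ) (_ : IsMVSolution E lam μ) (_ : μ 0 ∈ KBall M),
      thetaMoment (μ t)) atTop (𝓝 (thetaMoment ξstar))

/-- The pairing `⟨α, v⟩` of a finitely supported function `α` with `v ∈ ℝ^∞`. -/
def pairing (α : ℕ →₀ ℝ) (v : ℕ → ℝ) : ℝ := α.sum fun z a => a * v z

/-- Absolute continuity on `[0,T]` of a path of probability measures, seen as elements of the dual
of the space of finitely supported functions: for each finite `K ⊆ ℕ` there are a neighbourhood of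
`0` in the space of functions supported in `K`, and an absolutely continuous real function `H`,
such that `|⟨φ_s, f⟩ - ⟨φ_t, f⟩| ≤ |H(s) - H(t)|` for all `f` in this neighbourhood.
In particular each mass `t ↦ φ_t(z)` is absolutely continuous, and `φ` is continuous in total
variation on `[0,T]`. -/
def IsAbsolutelyContinuousPath (T : ℝ) (φ : ℝ → PMF ℕ) : Prop :=
  ∀ K : Finset ℕ, ∃ ε : ℝ, 0 < ε ∧ ∃ H : ℝ → ℝ, AbsolutelyContinuousOnInterval H 0 T ∧
    ∀ f : ℕ →₀ ℝ, f.support ⊆ K → (∀ z, |f z| < ε) →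
      ∀ s ∈ Set.Icc 0 T, ∀ t ∈ Set.Icc 0 T,
        |pairing f (mass (φ s)) - pairing f (mass (φ t))| ≤ |H s - H t|

/-- `⟨α, v - Λ_ξ^* ξ⟩ - ∑_{(z,z') ∈ E} τ(α(z') - α(z)) λ_{z,z'}(ξ) ξ(z)`. -/
def costFunctional (E : Set (ℕ × ℕ)) (lam : ℕ → ℕ → PMF ℕ → ℝ) (ξ : PMF ℕ) (v : ℕ → ℝ)
    (α : ℕ →₀ ℝ) : ℝ :=
  pairing α (fun z => v z - drift E lam ξ z) -
    ∑' e : E, tau (α e.1.2 - α e.1.1) * lam e.1.1 e.1.2 ξ * mass ξ e.1.1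

/-- The supremum of `costFunctional` over finitely supported `α`, as an element of `[0, ∞]`.
The choice `α = 0` shows that the supremum is nonnegative, so cutting the terms off at `0` does
not change it. -/
def localCost (E : Set (ℕ × ℕ)) (lam : ℕ → ℕ → PMF ℕ → ℝ) (ξ : PMF ℕ) (v : ℕ → ℝ) : ℝ≥0∞ :=
  ⨆ α : ℕ →₀ ℝ, ENNReal.ofReal (costFunctional E lam ξ v α)

open Classical in
/-- The cost `S_{[0,T]}(φ | ν)`. Only the restriction of `φ` to `[0,T]` matters; for absolutely
continuous `φ` the velocity `(d/dt) φ_t(z)` exists for all `z`, for almost every `t ∈ [0,T]`. -/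
def pathCost (E : Set (ℕ × ℕ)) (lam : ℕ → ℕ → PMF ℕ → ℝ) (T : ℝ) (φ : ℝ → PMF ℕ)
    (ν : PMF ℕ) : ℝ≥0∞ :=
  if φ 0 = ν ∧ IsAbsolutelyContinuousPath T φ then
    ∫⁻ t in Set.Icc 0 T, localCost E lam (φ t) (fun z => deriv (fun s => mass (φ s) z) t)
  else ⊤

/-- The Freidlin-Wentzell quasipotential
`V(ξ) = inf {S_{[0,T]}(φ | ξ*) : φ(0) = ξ*, φ(T) = ξ, T > 0}`. -/
def quasipotential (E : Set (ℕ × ℕ)) (lam : ℕ → ℕ → PMF ℕ → ℝ) (ξstar ξ : PMF ℕ) : ℝ≥0∞ :=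
  ⨅ (T : ℝ) (_ : 0 < T) (φ : ℝ → PMF ℕ) (_ : φ 0 = ξstar) (_ : φ T = ξ),
    pathCost E lam T φ ξstar

end MeanField

end

/-!
For fixed rates, the cost functional at `α` equals
`⟨α, v⟩ - ∑ (exp (α(z') - α(z)) - 1) λ_{z,z'} ξ(z)` (`costFunctional_forwardReset`), because the
compensator in `τ` cancels the drift. Both directions exploit this exponential form.

*Finite quasipotential implies a finite moment.* The forward rates are of order `1 / (z + 1)` and
`exp (ϑ(z+1) - ϑ(z)) ≤ e (z + 1)`, while resets only decrease `ϑ`. Hence `ϑ` (cut off to `0` beyond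
a finite level, which only adds a jump down) is a test function whose exponential term is bounded
by a constant, so that `d/dt ⟨φ_t, ϑ⟩` is at most the local cost plus a constant
(`pairing_thetaTrunc_le_costFunctional`). Integrating this with the fundamental theorem of calculus
for absolutely continuous functions bounds `⟨φ_T, ϑ⟩` by `⟨ξ*, ϑ⟩`, the cost and a multiple of `T`
(`thetaMoment_le_add_pathCost`).

*A finite moment implies a finite quasipotential.* An explicit path of duration `1` leads from any
law `ν` to `ξ`: a particle with target `z`, drawn from `ξ`, makes `z + 1` jumps at independent
uniform times in `[0,1]`, the first a reset to `0` and the others forward. The law of one such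
particle (`bridgeMass`) is given by Bernstein polynomials, whose derivatives are explicit fluxes.
The flux along an edge exceeds the flux under the natural rates by a factor of at most a constant
times `(z+1)² / (1-t)`, so that each of the `z + 1` jumps costs at most the logarithm of this factor
(`bridge_cost_le`). Since the functional is linear in the measure and its velocity once the rates
are fixed, these bounds can be averaged over `z` (`localCost_bridgePath_le`). The logarithmic
singularity at `t = 1` is integrable, and `(z+1) log (z+1)` is controlled by `ϑ(z)`, which bounds
the cost by an affine function of `⟨ξ, ϑ⟩` (`quasipotential_le`).
-/

noncomputable section

namespace MeanField

/-! ### Masses, pairings and moments -/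

lemma mass_nonneg (ξ : PMF ℕ) (z : ℕ) : 0 ≤ mass ξ z := ENNReal.toReal_nonneg

lemma hasSum_mass (ξ : PMF ℕ) : HasSum (mass ξ) 1 := by
  have h : ∑' z, ξ z ≠ ⊤ := by simp [ξ.tsum_coe]
  have := (ENNReal.summable_toReal h).hasSum
  rwa [← ENNReal.tsum_toReal_eq (fun z => ξ.apply_ne_top z), ξ.tsum_coe,
    ENNReal.toReal_one] at this

lemma mass_le_one (ξ : PMF ℕ) (z : ℕ) : mass ξ z ≤ 1 :=
  le_hasSum (hasSum_mass ξ) z fun w _ => mass_nonneg ξ w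

lemma summable_mass_mul (ξ : PMF ℕ) {f : ℕ → ℝ} {C : ℝ} (hf : ∀ z, |f z| ≤ C) :
    Summable fun z => mass ξ z * f z := by
  refine Summable.of_norm_bounded ((hasSum_mass ξ).summable.mul_right C) fun z => ?_
  rw [Real.norm_eq_abs, abs_mul, abs_of_nonneg (mass_nonneg ξ z)]
  exact mul_le_mul_of_nonneg_left (hf z) (mass_nonneg ξ z)

lemma vartheta_nonneg (z : ℕ) : 0 ≤ vartheta z := by
  unfold vartheta
  positivity

lemma vartheta_zero : vartheta 0 = 0 := by simp [vartheta]

/-- The increments of `ϑ` are logarithmic, so that `exp (ϑ(z+1) - ϑ(z))` is compensated by a jump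
rate of order `1 / (z + 1)`. -/
lemma vartheta_succ_sub_le (z : ℕ) :
    vartheta (z + 1) - vartheta z ≤ Real.log ((z : ℝ) + 1) + 1 := by
  rcases Nat.eq_zero_or_pos z with rfl | hz
  · simp [vartheta]
  have hz' : (0 : ℝ) < z := by exact_mod_cast hz
  have h := Real.log_le_sub_one_of_pos (show (0 : ℝ) < ((z : ℝ) + 1) / z by positivity)
  rw [Real.log_div (by positivity) hz'.ne'] at h
  have h2 : (z : ℝ) * (Real.log ((z : ℝ) + 1) - Real.log z) ≤ z * (((z : ℝ) + 1) / z - 1) :=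
    mul_le_mul_of_nonneg_left h hz'.le
  have h3 : (z : ℝ) * (((z : ℝ) + 1) / z - 1) = 1 := by field_simp; ring
  simp only [vartheta]
  push_cast
  nlinarith

lemma add_one_le_vartheta (z : ℕ) : (z : ℝ) + 1 ≤ 4 + vartheta z := by
  rcases Nat.lt_or_ge z 4 with hz | hz
  · have : (z : ℝ) ≤ 3 := by exact_mod_cast (by omega : z ≤ 3)
    linarith [vartheta_nonneg z]
  · have hz' : (4 : ℝ) ≤ z := by exact_mod_cast hz
    have : 1 ≤ Real.log z := by
      rw [Real.le_log_iff_exp_le (by linarith)]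
      linarith [Real.exp_one_lt_d9]
    unfold vartheta
    nlinarith

lemma add_one_mul_log_le_vartheta (z : ℕ) :
    ((z : ℝ) + 1) * Real.log ((z : ℝ) + 1) ≤ 4 + 2 * vartheta z := by
  have h1 := vartheta_succ_sub_le z
  have h2 := add_one_le_vartheta z
  have h3 : Real.log ((z : ℝ) + 1) ≤ z := by
    have := Real.log_le_sub_one_of_pos (show (0 : ℝ) < (z : ℝ) + 1 by positivity)
    linarith
  have h4 : vartheta (z + 1) = ((z : ℝ) + 1) * Real.log ((z : ℝ) + 1) := by
    simp [vartheta]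
  linarith

lemma pairing_eq_sum {α : ℕ →₀ ℝ} {s : Finset ℕ} (h : α.support ⊆ s) (v : ℕ → ℝ) :
    pairing α v = ∑ z ∈ s, α z * v z :=
  Finsupp.sum_of_support_subset _ h _ (by simp)

lemma exists_abs_le (α : ℕ →₀ ℝ) : ∃ C, 0 ≤ C ∧ ∀ z, |α z| ≤ C := by
  refine ⟨∑ z ∈ α.support, |α z|, by positivity, fun z => ?_⟩
  by_cases hz : z ∈ α.support
  · exact Finset.single_le_sum (f := fun z => |α z|) (fun _ _ => abs_nonneg _) hz
  · rw [Finsupp.notMem_support_iff.1 hz, abs_zero]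
    positivity

/-! ### The cost functional on the forward-reset graph -/

/-- The rate of the forward jump `z → z + 1`. -/
def fwdRate (lam : ℕ → ℕ → PMF ℕ → ℝ) (ξ : PMF ℕ) (z : ℕ) : ℝ := lam z (z + 1) ξ

/-- The rate of the reset `z → 0`, set to `0` at `z = 0`, where there is no such edge. -/
def resetRate (lam : ℕ → ℕ → PMF ℕ → ℝ) (ξ : PMF ℕ) (z : ℕ) : ℝ := if z = 0 then 0 else lam z 0 ξ

lemma mem_forwardResetEdges {z w : ℕ} :
    (z, w) ∈ forwardResetEdges ↔ w = z + 1 ∨ (z ≠ 0 ∧ w = 0) := by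
  simp only [forwardResetEdges, Set.mem_union, Set.mem_ofPred_eq, Prod.mk.injEq]
  constructor
  · rintro (⟨x, rfl, rfl⟩ | ⟨x, hx, rfl, rfl⟩)
    · simp
    · exact Or.inr ⟨hx, rfl⟩
  · rintro (rfl | ⟨h, rfl⟩)
    · exact Or.inl ⟨z, rfl, rfl⟩
    · exact Or.inr ⟨z, h, rfl, rfl⟩

lemma rateMatrix_forwardReset (lam : ℕ → ℕ → PMF ℕ → ℝ) (ξ : PMF ℕ) (w z : ℕ) :
    rateMatrix forwardResetEdges lam ξ w z =
      fwdRate lam ξ w * ((if z = w + 1 then 1 else 0) - (if z = w then 1 else 0)) +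
      resetRate lam ξ w * ((if z = 0 then 1 else 0) - (if z = w then 1 else 0)) := by
  classical
  unfold rateMatrix
  by_cases hwz : w = z
  · subst hwz
    have hsum : (∑' x : ℕ, (if (w, x) ∈ forwardResetEdges ∧ x ≠ w then lam w x ξ else 0)) =
        fwdRate lam ξ w + resetRate lam ξ w := by
      have h0 : ∀ x ∉ ({w + 1, 0} : Finset ℕ),
          (if (w, x) ∈ forwardResetEdges ∧ x ≠ w then lam w x ξ else 0) = 0 := by
        intro x hx
        simp only [Finset.mem_insert, Finset.mem_singleton, not_or] at hx
        rw [if_neg]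
        rw [mem_forwardResetEdges]
        tauto
      rw [tsum_eq_sum h0, Finset.sum_pair (by omega)]
      simp only [mem_forwardResetEdges, fwdRate, resetRate]
      rcases Nat.eq_zero_or_pos w with rfl | hw
      · simp
      · simp [hw.ne', hw.ne]
    rw [if_pos rfl, hsum]
    rcases Nat.eq_zero_or_pos w with rfl | hw
    · simp [resetRate]
    · simp [hw.ne']
      ring
  · rw [if_neg hwz]
    simp only [mem_forwardResetEdges, if_neg (Ne.symm hwz), fwdRate, resetRate]
    rcases Nat.eq_zero_or_pos z with rfl | hz
    · simp [hwz]
    · by_cases h : z = w + 1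
      · simp [h]
      · simp [h, hz.ne']

/-- The drift, tested against `α`, is the expected generator applied to `α`. -/
lemma pairing_drift {lam : ℕ → ℕ → PMF ℕ → ℝ} {ξ : PMF ℕ} {C : ℝ}
    (hf : ∀ z, |fwdRate lam ξ z| ≤ C) (hr : ∀ z, |resetRate lam ξ z| ≤ C) (α : ℕ →₀ ℝ) :
    pairing α (drift forwardResetEdges lam ξ) =
      ∑' z, mass ξ z * (fwdRate lam ξ z * (α (z + 1) - α z) +
        resetRate lam ξ z * (α 0 - α z)) := by
  have hC : 0 ≤ C := (abs_nonneg _).trans (hf 0)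
  have hbd : ∀ w z, |rateMatrix forwardResetEdges lam ξ w z| ≤ 2 * C := by
    intro w z
    have hi : ∀ (p q : Prop) [Decidable p] [Decidable q],
        |(if p then (1 : ℝ) else 0) - (if q then 1 else 0)| ≤ 1 := by
      intro p q _ _
      split_ifs <;> norm_num
    rw [rateMatrix_forwardReset]
    refine (abs_add_le _ _).trans ?_
    rw [abs_mul, abs_mul, two_mul]
    exact add_le_add
      ((mul_le_mul (hf w) (hi _ _) (abs_nonneg _) hC).trans_eq (mul_one C))
      ((mul_le_mul (hr w) (hi _ _) (abs_nonneg _) hC).trans_eq (mul_one C))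
  have hsum : ∀ z ∈ α.support, Summable fun w =>
      α z * (rateMatrix forwardResetEdges lam ξ w z * mass ξ w) := fun z _ => by
    refine Summable.mul_left _ ?_
    simpa only [mul_comm] using summable_mass_mul ξ fun w => hbd w z
  rw [pairing, Finsupp.sum]
  simp only [drift, ← tsum_mul_left]
  rw [← Summable.tsum_finsetSum hsum]
  refine tsum_congr fun w => ?_
  have hpick : ∀ y : ℕ, ∑ z ∈ α.support, α z * (if z = y then (1 : ℝ) else 0) = α y := by
    intro y
    simp
    tauto
  calc ∑ z ∈ α.support, α z * (rateMatrix forwardResetEdges lam ξ w z * mass ξ w)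
      = mass ξ w * (fwdRate lam ξ w *
          (∑ z ∈ α.support, α z * (if z = w + 1 then (1 : ℝ) else 0) -
            ∑ z ∈ α.support, α z * (if z = w then (1 : ℝ) else 0)) +
        resetRate lam ξ w *
          (∑ z ∈ α.support, α z * (if z = 0 then (1 : ℝ) else 0) -
            ∑ z ∈ α.support, α z * (if z = w then (1 : ℝ) else 0))) := by
        simp only [← Finset.sum_sub_distrib, Finset.mul_sum, ← Finset.sum_add_distrib]
        refine Finset.sum_congr rfl fun z _ => ?_
        rw [rateMatrix_forwardReset]
        ring
    _ = _ := by simp only [hpick]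

/-- A sum over the forward-reset edges is a sum over their sources. -/
lemma tsum_forwardResetEdges {f : ℕ → ℕ → ℝ}
    (h1 : Summable fun z => f z (z + 1)) (h2 : Summable fun z => if z = 0 then 0 else f z 0) :
    ∑' e : forwardResetEdges, f e.1.1 e.1.2 =
      ∑' z, (f z (z + 1) + if z = 0 then 0 else f z 0) := by
  have hset : forwardResetEdges =
      Set.range (fun z : ℕ => (z, z + 1)) ∪ Set.range (fun z : ℕ => (z + 1, 0)) := by
    ext ⟨z, w⟩
    rw [mem_forwardResetEdges]
    simp only [Set.mem_union, Set.mem_range, Prod.mk.injEq]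
    constructor
    · rintro (rfl | ⟨hz, rfl⟩)
      · exact Or.inl ⟨z, rfl, rfl⟩
      · exact Or.inr ⟨z - 1, by omega, rfl⟩
    · rintro (⟨x, rfl, rfl⟩ | ⟨x, rfl, rfl⟩) <;> simp
  have hdisj : Disjoint (Set.range (fun z : ℕ => (z, z + 1)))
      (Set.range (fun z : ℕ => (z + 1, 0))) := by
    rw [Set.disjoint_left]
    rintro _ ⟨x, rfl⟩ ⟨y, hy⟩
    simp at hy
  have i1 : Function.Injective (fun z : ℕ => (z, z + 1)) := fun a b h => by simpa using h
  have i2 : Function.Injective (fun z : ℕ => (z + 1, 0)) := fun a b h => by simpa using h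
  let F : ℕ × ℕ → ℝ := fun p => f p.1 p.2
  have s1 : HasSum (F ∘ ((↑) : Set.range (fun z : ℕ => (z, z + 1)) → ℕ × ℕ))
      (∑' z, f z (z + 1)) := (i1.hasSum_range_iff).2 h1.hasSum
  have s2' : HasSum (fun z => f (z + 1) 0) (∑' z, if z = 0 then 0 else f z 0) := by
    have := (hasSum_nat_add_iff' 1).2 h2.hasSum
    simpa using this
  have s2 : HasSum (F ∘ ((↑) : Set.range (fun z : ℕ => (z + 1, 0)) → ℕ × ℕ))
      (∑' z, if z = 0 then 0 else f z 0) := (i2.hasSum_range_iff).2 s2'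
  have s3 := s1.add_disjoint hdisj s2
  rw [← hset] at s3
  rw [h1.tsum_add h2]
  exact s3.tsum_eq

/-- The compensator in `τ` cancels the drift, leaving an exponential functional which, for fixed
rates, is linear in the pair formed by the velocity and the measure. -/
lemma costFunctional_forwardReset {lam : ℕ → ℕ → PMF ℕ → ℝ} {ξ : PMF ℕ} {C : ℝ}
    (hf : ∀ z, |fwdRate lam ξ z| ≤ C) (hr : ∀ z, |resetRate lam ξ z| ≤ C)
    (v : ℕ → ℝ) (α : ℕ →₀ ℝ) :
    costFunctional forwardResetEdges lam ξ v α =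
      pairing α v - ∑' z, mass ξ z * (fwdRate lam ξ z * (Real.exp (α (z + 1) - α z) - 1) +
        resetRate lam ξ z * (Real.exp (α 0 - α z) - 1)) := by
  have hC : 0 ≤ C := (abs_nonneg _).trans (hf 0)
  obtain ⟨A, hA, hαA⟩ := exists_abs_le α
  have hinc : ∀ z w, |α w - α z| ≤ 2 * A := fun z w => by
    have := abs_sub (α w) (α z)
    linarith [hαA z, hαA w]
  have htau : ∀ z w, |tau (α w - α z)| ≤ Real.exp (2 * A) + 2 * A + 1 := fun z w => by
    have h := abs_le.1 (hinc z w)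
    have h1 := Real.exp_le_exp.2 h.2
    have h2 := Real.exp_pos (α w - α z)
    unfold tau
    rw [abs_le]
    constructor <;> linarith [Real.exp_pos (2 * A)]
  have hmul : ∀ {g r : ℕ → ℝ} {B : ℝ}, (∀ z, |r z| ≤ C) → (∀ z, |g z| ≤ B) →
      Summable fun z => mass ξ z * (r z * g z) := fun {g r B} h1 h2 =>
    summable_mass_mul (C := C * B) ξ fun z => by
      rw [abs_mul]
      exact mul_le_mul (h1 z) (h2 z) (abs_nonneg _) hC
  have e1 : ∀ z, tau (α (z + 1) - α z) * lam z (z + 1) ξ * mass ξ z =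
      mass ξ z * (fwdRate lam ξ z * tau (α (z + 1) - α z)) := fun z => by
    unfold fwdRate; ring
  have e2 : ∀ z, (if z = 0 then 0 else tau (α 0 - α z) * lam z 0 ξ * mass ξ z) =
      mass ξ z * (resetRate lam ξ z * tau (α 0 - α z)) := fun z => by
    unfold resetRate
    split_ifs
    · simp
    · ring
  have s1 : Summable fun z => mass ξ z * (fwdRate lam ξ z * tau (α (z + 1) - α z)) :=
    hmul hf fun z => htau z (z + 1)
  have s2 : Summable fun z => mass ξ z * (resetRate lam ξ z * tau (α 0 - α z)) :=
    hmul hr fun z => htau z 0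
  have hE := tsum_forwardResetEdges (f := fun z w => tau (α w - α z) * lam z w ξ * mass ξ z)
    (by simpa only [e1] using s1) (by simpa only [e2] using s2)
  have s3 : Summable fun z => mass ξ z * (fwdRate lam ξ z * (α (z + 1) - α z) +
      resetRate lam ξ z * (α 0 - α z)) := by
    simp only [mul_add]
    exact (hmul hf fun z => hinc z (z + 1)).add (hmul hr fun z => hinc z 0)
  have hsub : pairing α (fun z => v z - drift forwardResetEdges lam ξ z) =
      pairing α v - pairing α (drift forwardResetEdges lam ξ) := by
    simp only [pairing, Finsupp.sum, mul_sub, Finset.sum_sub_distrib]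
  rw [costFunctional, hE, hsub, pairing_drift hf hr, sub_sub]
  simp only [e1, e2]
  rw [← s3.tsum_add (s1.add s2)]
  congr 1
  refine tsum_congr fun z => ?_
  unfold tau
  ring

/-- The two-sided bounds on the rates with explicit constants, in terms of `fwdRate` and
`resetRate`. -/
structure HasRateBounds (lam : ℕ → ℕ → PMF ℕ → ℝ) (lo hi : ℝ) : Prop where
  lo_pos : 0 < lo
  hi_pos : 0 < hi
  le_fwd : ∀ (ξ : PMF ℕ) (z : ℕ), lo / ((z : ℝ) + 1) ≤ fwdRate lam ξ z
  fwd_le : ∀ (ξ : PMF ℕ) (z : ℕ), fwdRate lam ξ z ≤ hi / ((z : ℝ) + 1)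
  le_reset : ∀ ξ z, z ≠ 0 → lo ≤ resetRate lam ξ z
  reset_nonneg : ∀ ξ z, 0 ≤ resetRate lam ξ z
  reset_le : ∀ ξ z, resetRate lam ξ z ≤ hi

namespace HasRateBounds

variable {lam : ℕ → ℕ → PMF ℕ → ℝ} {lo hi : ℝ}

lemma fwd_nonneg (h : HasRateBounds lam lo hi) (ξ : PMF ℕ) (z : ℕ) : 0 ≤ fwdRate lam ξ z :=
  (div_nonneg h.lo_pos.le (by positivity)).trans (h.le_fwd ξ z)

lemma fwd_le_hi (h : HasRateBounds lam lo hi) (ξ : PMF ℕ) (z : ℕ) : fwdRate lam ξ z ≤ hi :=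
  (h.fwd_le ξ z).trans (div_le_self h.hi_pos.le (by linarith [z.cast_nonneg (α := ℝ)]))

lemma abs_fwd_le (h : HasRateBounds lam lo hi) (ξ : PMF ℕ) (z : ℕ) : |fwdRate lam ξ z| ≤ hi := by
  rw [abs_of_nonneg (h.fwd_nonneg ξ z)]
  exact h.fwd_le_hi ξ z

lemma abs_reset_le (h : HasRateBounds lam lo hi) (ξ : PMF ℕ) (z : ℕ) :
    |resetRate lam ξ z| ≤ hi := by
  rw [abs_of_nonneg (h.reset_nonneg ξ z)]
  exact h.reset_le ξ z

end HasRateBounds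

lemma RateBounds.exists_hasRateBounds {lam : ℕ → ℕ → PMF ℕ → ℝ} (h : RateBounds lam) :
    ∃ lo hi, HasRateBounds lam lo hi := by
  obtain ⟨lo, hi, hlo, hhi, H⟩ := h
  refine ⟨lo, hi, hlo, hhi, fun ξ z => ((H ξ).1 z).1, fun ξ z => ((H ξ).1 z).2,
    fun ξ z hz => ?_, fun ξ z => ?_, fun ξ z => ?_⟩
  · simpa [resetRate, hz] using ((H ξ).2 z hz).1
  · unfold resetRate
    split_ifs with hz
    · exact le_rfl
    · exact hlo.le.trans ((H ξ).2 z hz).1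
  · unfold resetRate
    split_ifs with hz
    · exact hhi.le
    · exact ((H ξ).2 z hz).2

/-! ### Finite cost forces a finite moment -/

/-- The test function `ϑ` cut off to `0` from `n` on. -/
def thetaTrunc (n : ℕ) : ℕ →₀ ℝ :=
  Finsupp.onFinset (Finset.range n) (fun z => if z < n then vartheta z else 0) fun z hz => by
    rw [Finset.mem_range]
    by_contra h
    exact hz (if_neg h)

lemma thetaTrunc_apply (n z : ℕ) : thetaTrunc n z = if z < n then vartheta z else 0 := rfl

lemma thetaTrunc_nonneg (n z : ℕ) : 0 ≤ thetaTrunc n z := by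
  rw [thetaTrunc_apply]
  split_ifs
  · exact vartheta_nonneg z
  · exact le_rfl

lemma pairing_thetaTrunc (n : ℕ) (v : ℕ → ℝ) :
    pairing (thetaTrunc n) v = ∑ z ∈ Finset.range n, vartheta z * v z := by
  have hs : (thetaTrunc n).support ⊆ Finset.range n := Finsupp.support_onFinset_subset
  rw [pairing_eq_sum hs]
  refine Finset.sum_congr rfl fun z hz => ?_
  rw [thetaTrunc_apply, if_pos (Finset.mem_range.1 hz)]

/-- The cut-off of `ϑ` is a jump down, so it preserves the upper bound on forward increments. -/
lemma thetaTrunc_succ_sub_le (n z : ℕ) :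
    thetaTrunc n (z + 1) - thetaTrunc n z ≤ Real.log ((z : ℝ) + 1) + 1 := by
  have hlog : 0 ≤ Real.log ((z : ℝ) + 1) := Real.log_nonneg (by linarith [z.cast_nonneg (α := ℝ)])
  have h0 := thetaTrunc_nonneg n z
  by_cases h : z + 1 < n
  · rw [thetaTrunc_apply, thetaTrunc_apply, if_pos h, if_pos (by omega)]
    exact vartheta_succ_sub_le z
  · have : thetaTrunc n (z + 1) = 0 := by rw [thetaTrunc_apply, if_neg h]
    linarith

/-- `ϑ` is an exponential Lyapunov function: along any velocity, the moment grows at a rate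
bounded by the local cost plus a constant, uniformly in the truncation. -/
lemma pairing_thetaTrunc_le_costFunctional {lam : ℕ → ℕ → PMF ℕ → ℝ} {lo hi : ℝ}
    (h : HasRateBounds lam lo hi) (ξ : PMF ℕ) (v : ℕ → ℝ) (n : ℕ) :
    pairing (thetaTrunc n) v ≤
      costFunctional forwardResetEdges lam ξ v (thetaTrunc n) + hi * Real.exp 1 := by
  rw [costFunctional_forwardReset (h.abs_fwd_le ξ) (h.abs_reset_le ξ)]
  have hterm : ∀ z, mass ξ z *
      (fwdRate lam ξ z * (Real.exp (thetaTrunc n (z + 1) - thetaTrunc n z) - 1) +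
        resetRate lam ξ z * (Real.exp (thetaTrunc n 0 - thetaTrunc n z) - 1)) ≤
      mass ξ z * (hi * Real.exp 1) := by
    intro z
    have hz : (0 : ℝ) < (z : ℝ) + 1 := by positivity
    refine mul_le_mul_of_nonneg_left ?_ (mass_nonneg ξ z)
    have h1 : Real.exp (thetaTrunc n (z + 1) - thetaTrunc n z) - 1 ≤
        ((z : ℝ) + 1) * Real.exp 1 := by
      have := Real.exp_le_exp.2 (thetaTrunc_succ_sub_le n z)
      rw [Real.exp_add, Real.exp_log hz] at this
      linarith
    have h2 : fwdRate lam ξ z * (Real.exp (thetaTrunc n (z + 1) - thetaTrunc n z) - 1) ≤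
        hi * Real.exp 1 := by
      calc _ ≤ fwdRate lam ξ z * (((z : ℝ) + 1) * Real.exp 1) :=
            mul_le_mul_of_nonneg_left h1 (h.fwd_nonneg ξ z)
        _ ≤ hi / ((z : ℝ) + 1) * (((z : ℝ) + 1) * Real.exp 1) :=
            mul_le_mul_of_nonneg_right (h.fwd_le ξ z) (by positivity)
        _ = hi * Real.exp 1 := by field_simp
    have h3 : Real.exp (thetaTrunc n 0 - thetaTrunc n z) ≤ 1 := by
      rw [Real.exp_le_one_iff]
      have : thetaTrunc n 0 = 0 := by simp [thetaTrunc_apply, vartheta_zero]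
      linarith [thetaTrunc_nonneg n z]
    nlinarith [h.reset_nonneg ξ z]
  have hle : (∑' z, mass ξ z *
      (fwdRate lam ξ z * (Real.exp (thetaTrunc n (z + 1) - thetaTrunc n z) - 1) +
        resetRate lam ξ z * (Real.exp (thetaTrunc n 0 - thetaTrunc n z) - 1))) ≤
      hi * Real.exp 1 := by
    have hs := (hasSum_mass ξ).mul_right (hi * Real.exp 1)
    rw [one_mul] at hs
    by_cases hsum : Summable fun z => mass ξ z *
      (fwdRate lam ξ z * (Real.exp (thetaTrunc n (z + 1) - thetaTrunc n z) - 1) +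
        resetRate lam ξ z * (Real.exp (thetaTrunc n 0 - thetaTrunc n z) - 1))
    · exact hasSum_le hterm hsum.hasSum hs
    · -- Summability need not be checked: the value `0` of a divergent series obeys the bound.
      rw [tsum_eq_zero_of_not_summable hsum]
      have := h.hi_pos
      positivity
  linarith

lemma ofReal_pairing_thetaTrunc (n : ℕ) (ξ : PMF ℕ) :
    ENNReal.ofReal (pairing (thetaTrunc n) (mass ξ)) =
      ∑ z ∈ Finset.range n, ξ z * ENNReal.ofReal (vartheta z) := by
  rw [pairing_thetaTrunc, ENNReal.ofReal_sum_of_nonneg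
    fun z _ => mul_nonneg (vartheta_nonneg z) (mass_nonneg ξ z)]
  refine Finset.sum_congr rfl fun z _ => ?_
  rw [ENNReal.ofReal_mul (vartheta_nonneg z), mul_comm, mass,
    ENNReal.ofReal_toReal (ξ.apply_ne_top z)]

lemma _root_.AbsolutelyContinuousOnInterval.of_abs_sub_le {f g : ℝ → ℝ} {T C : ℝ} (hT : 0 ≤ T)
    (hg : AbsolutelyContinuousOnInterval g 0 T)
    (h : ∀ s ∈ Set.Icc 0 T, ∀ t ∈ Set.Icc 0 T, |f s - f t| ≤ C * |g s - g t|) :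
    AbsolutelyContinuousOnInterval f 0 T := by
  have hCg := hg.const_mul C
  rw [absolutelyContinuousOnInterval_iff] at hCg ⊢
  intro ε hε
  obtain ⟨δ, hδ, H⟩ := hCg ε hε
  refine ⟨δ, hδ, fun F hF hlt => (Finset.sum_le_sum fun i hi => ?_).trans_lt (H F hF hlt)⟩
  have hmem := hF.1 i hi
  rw [Set.uIcc_of_le hT] at hmem
  simp only [Real.dist_eq, ← mul_sub, abs_mul]
  exact (h _ hmem.1 _ hmem.2).trans
    (mul_le_mul_of_nonneg_right (le_abs_self C) (abs_nonneg _))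

/-- Each pairing with a finitely supported function is absolutely continuous along an absolutely
continuous path. -/
lemma IsAbsolutelyContinuousPath.pairing {T : ℝ} (hT : 0 ≤ T) {φ : ℝ → PMF ℕ}
    (h : IsAbsolutelyContinuousPath T φ) (α : ℕ →₀ ℝ) :
    AbsolutelyContinuousOnInterval (fun t => pairing α (mass (φ t))) 0 T := by
  obtain ⟨ε, hε, H, hH, hle⟩ := h α.support
  obtain ⟨A, hA, hαA⟩ := exists_abs_le α
  -- Scale `α` into the neighbourhood given by the definition.
  let c : ℝ := ε / (A + 1)
  have hc : 0 < c := by positivity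
  refine AbsolutelyContinuousOnInterval.of_abs_sub_le (C := c⁻¹) hT hH fun s hs t ht => ?_
  have hp : ∀ u, MeanField.pairing (c • α) (mass (φ u)) = c * MeanField.pairing α (mass (φ u)) := by
    intro u
    rw [pairing_eq_sum (s := α.support) Finsupp.support_smul, MeanField.pairing, Finsupp.sum,
      Finset.mul_sum]
    exact Finset.sum_congr rfl fun z _ => by simp [mul_assoc]
  have h1 := hle (c • α) Finsupp.support_smul (fun z => by
    rw [Finsupp.smul_apply, smul_eq_mul, abs_mul, abs_of_pos hc]
    calc c * |α z| ≤ c * A := mul_le_mul_of_nonneg_left (hαA z) hc.le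
      _ < c * (A + 1) := by nlinarith
      _ = ε := by simp only [c]; field_simp) s hs t ht
  rw [hp, hp, ← mul_sub, abs_mul, abs_of_pos hc] at h1
  rw [le_inv_mul_iff₀ hc]
  exact h1

lemma pairing_single_one (z : ℕ) (v : ℕ → ℝ) : pairing (Finsupp.single z 1) v = v z := by
  simp [pairing]

/-- Integrating the Lyapunov estimate along a path. -/
lemma thetaMoment_le_add_pathCost {lam : ℕ → ℕ → PMF ℕ → ℝ} {lo hi : ℝ}
    (h : HasRateBounds lam lo hi) {T : ℝ} (hT : 0 < T) {φ : ℝ → PMF ℕ} {ν : PMF ℕ} :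
    thetaMoment (φ T) ≤ thetaMoment ν + (pathCost forwardResetEdges lam T φ ν +
      ENNReal.ofReal (hi * Real.exp 1) * ENNReal.ofReal T) := by
  unfold pathCost
  split_ifs with hφ
  swap
  · simp
  obtain ⟨rfl, hac⟩ := hφ
  refine ENNReal.tsum_le_of_sum_range_le fun n => ?_
  rw [← ofReal_pairing_thetaTrunc]
  set g : ℝ → ℝ := fun t => pairing (thetaTrunc n) (mass (φ t)) with hg
  have hgac : AbsolutelyContinuousOnInterval g 0 T := hac.pairing hT.le _
  have hmass : ∀ z, AbsolutelyContinuousOnInterval (fun t => mass (φ t) z) 0 T := fun z => by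
    simpa only [pairing_single_one] using hac.pairing hT.le (Finsupp.single z 1)
  have hdiff : ∀ᵐ t, ∀ z, t ∈ Set.uIcc 0 T → DifferentiableAt ℝ (fun s => mass (φ s) z) t :=
    ae_all_iff.2 fun z => (hmass z).ae_differentiableAt
  have hderiv : ∀ᵐ t ∂volume.restrict (Set.Icc 0 T), ENNReal.ofReal (deriv g t) ≤
      localCost forwardResetEdges lam (φ t) (fun z => deriv (fun s => mass (φ s) z) t) +
        ENNReal.ofReal (hi * Real.exp 1) := by
    rw [ae_restrict_iff' measurableSet_Icc]
    filter_upwards [hdiff] with t ht htT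
    rw [← Set.uIcc_of_le hT.le] at htT
    have hgd : deriv g t =
        pairing (thetaTrunc n) (fun z => deriv (fun s => mass (φ s) z) t) := by
      have : HasDerivAt (fun s => ∑ z ∈ Finset.range n, vartheta z * mass (φ s) z)
          (∑ z ∈ Finset.range n, vartheta z * deriv (fun s => mass (φ s) z) t) t :=
        HasDerivAt.fun_sum fun z _ => (ht z htT).hasDerivAt.const_mul _
      simp only [hg, pairing_thetaTrunc]
      exact this.deriv
    rw [hgd]
    calc _ ≤ ENNReal.ofReal (costFunctional forwardResetEdges lam (φ t)
            (fun z => deriv (fun s => mass (φ s) z) t) (thetaTrunc n) + hi * Real.exp 1) :=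
          ENNReal.ofReal_le_ofReal (pairing_thetaTrunc_le_costFunctional h _ _ n)
      _ ≤ _ := ENNReal.ofReal_add_le
      _ ≤ _ := by
          gcongr
          exact le_iSup (fun α => ENNReal.ofReal (costFunctional forwardResetEdges lam (φ t)
            (fun z => deriv (fun s => mass (φ s) z) t) α)) _
  have hint : g T = g 0 + ∫ t in Set.Ioc 0 T, deriv g t := by
    rw [← intervalIntegral.integral_of_le hT.le, hgac.integral_deriv_eq_sub]
    ring
  have hbound : ENNReal.ofReal (∫ t in Set.Ioc 0 T, deriv g t) ≤
      (∫⁻ t in Set.Icc 0 T, localCost forwardResetEdges lam (φ t)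
        (fun z => deriv (fun s => mass (φ s) z) t)) +
      ENNReal.ofReal (hi * Real.exp 1) * ENNReal.ofReal T := by
    calc _ ≤ ∫⁻ t in Set.Ioc 0 T, ENNReal.ofReal (deriv g t) := by
          rw [integral_eq_lintegral_pos_part_sub_lintegral_neg_part
            ((intervalIntegrable_iff_integrableOn_Ioc_of_le hT.le).1 hgac.intervalIntegrable_deriv)]
          exact (ENNReal.ofReal_le_ofReal (sub_le_self _ ENNReal.toReal_nonneg)).trans
            ENNReal.ofReal_toReal_le
      _ ≤ ∫⁻ t in Set.Icc 0 T, ENNReal.ofReal (deriv g t) :=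
          lintegral_mono_set Set.Ioc_subset_Icc_self
      _ ≤ _ := lintegral_mono_ae hderiv
      _ = _ := by
          rw [lintegral_add_right _ measurable_const, setLIntegral_const, Real.volume_Icc, sub_zero]
  calc ENNReal.ofReal (g T) ≤ ENNReal.ofReal (g 0) +
        ENNReal.ofReal (∫ t in Set.Ioc 0 T, deriv g t) := by
        rw [hint]
        exact ENNReal.ofReal_add_le
    _ ≤ _ := by
        gcongr
        rw [hg, ofReal_pairing_thetaTrunc]
        exact ENNReal.sum_le_tsum _

lemma mem_KSet_iff {ξ : PMF ℕ} : ξ ∈ KSet ↔ thetaMoment ξ < ⊤ := by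
  simp only [KSet, Set.mem_iUnion, KBall, Set.mem_ofPred_eq]
  constructor
  · rintro ⟨M, -, hM⟩
    exact hM.trans_lt ENNReal.ofReal_lt_top
  · intro h
    refine ⟨max 1 (thetaMoment ξ).toReal, Set.mem_Ici.2 (le_max_left _ _), ?_⟩
    exact (ENNReal.le_ofReal_iff_toReal_le h.ne (by positivity)).2 (le_max_right _ _)

lemma mem_KSet_of_quasipotential_lt_top {lam : ℕ → ℕ → PMF ℕ → ℝ} {lo hi : ℝ}
    (h : HasRateBounds lam lo hi) {ξstar ξ : PMF ℕ} (hstar : thetaMoment ξstar < ⊤)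
    (hV : quasipotential forwardResetEdges lam ξstar ξ < ⊤) : ξ ∈ KSet := by
  simp only [quasipotential, iInf_lt_iff] at hV
  obtain ⟨T, hT, φ, -, rfl, hcost⟩ := hV
  exact mem_KSet_iff.2 ((thetaMoment_le_add_pathCost h hT (ν := ξstar)).trans_lt (by
    simp [hstar, hcost, ENNReal.mul_lt_top]))

/-! ### Bernstein polynomials as jump chains -/

/-- The probability `C(n,k) t^k (1-t)^(n-k)` that `k` of `n` independent jumps, each made at a
uniform time in `[0,1]`, have been made by time `t`. -/
def bern (n k : ℕ) (t : ℝ) : ℝ := (bernsteinPolynomial ℝ n k).eval t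

lemma bern_eq (n k : ℕ) (t : ℝ) : bern n k t = n.choose k * t ^ k * (1 - t) ^ (n - k) := by
  simp [bern, bernsteinPolynomial]

lemma bern_nonneg (n k : ℕ) {t : ℝ} (ht : t ∈ Set.Icc (0 : ℝ) 1) : 0 ≤ bern n k t := by
  have h0 := ht.1
  have h1 : 0 ≤ 1 - t := sub_nonneg.2 ht.2
  rw [bern_eq]
  positivity

lemma bern_of_lt {n k : ℕ} (h : n < k) (t : ℝ) : bern n k t = 0 := by
  simp [bern, bernsteinPolynomial.eq_zero_of_lt ℝ h]

lemma hasSum_bern (n : ℕ) (t : ℝ) : HasSum (fun k => bern n k t) 1 := by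
  have h := congrArg (Polynomial.eval t) (bernsteinPolynomial.sum ℝ n)
  rw [Polynomial.eval_finsetSum, Polynomial.eval_one] at h
  rw [← h]
  refine hasSum_sum_of_ne_finset_zero fun k hk => bern_of_lt ?_ t
  simpa using hk

lemma bern_le_one (n k : ℕ) {t : ℝ} (ht : t ∈ Set.Icc (0 : ℝ) 1) : bern n k t ≤ 1 :=
  le_hasSum (hasSum_bern n t) k fun j _ => bern_nonneg n j ht

lemma hasDerivAt_bern_succ (n k : ℕ) (t : ℝ) : HasDerivAt (bern (n + 1) (k + 1))
    (((n : ℝ) + 1) * (bern n k t - bern n (k + 1) t)) t := by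
  have h := (bernsteinPolynomial ℝ (n + 1) (k + 1)).hasDerivAt t
  rw [bernsteinPolynomial.derivative_succ] at h
  refine h.congr_deriv ?_
  simp [bern]

lemma hasDerivAt_bern_zero (n : ℕ) (t : ℝ) : HasDerivAt (bern (n + 1) 0)
    (-(((n : ℝ) + 1) * bern n 0 t)) t := by
  have h := (bernsteinPolynomial ℝ (n + 1) 0).hasDerivAt t
  rw [bernsteinPolynomial.derivative_zero] at h
  convert! h using 1
  simp [bern]
  ring

lemma bern_succ_zero (n : ℕ) (t : ℝ) : bern (n + 1) 0 t = (1 - t) * bern n 0 t := by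
  simp [bern_eq, pow_succ']

/-- The flux out of the state `k + 1` is at most `(n+1)² / ((k+1)(1-t))` times its mass. -/
lemma bern_flux_le (n k : ℕ) {t : ℝ} (ht : t ∈ Set.Icc (0 : ℝ) 1) :
    ((n : ℝ) + 1) * bern n (k + 1) t * ((1 - t) * ((k : ℝ) + 1)) ≤
      ((n : ℝ) + 1) ^ 2 * bern (n + 1) (k + 1) t := by
  have hb := bern_nonneg (n + 1) (k + 1) ht
  rcases Nat.lt_or_ge n (k + 1) with h | h
  · rw [bern_of_lt h]
    simp only [mul_zero, zero_mul]
    positivity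
  obtain ⟨j, rfl⟩ := Nat.exists_eq_add_of_le h
  have hch : (((k + 1 + j).choose (k + 1) : ℕ) : ℝ) * ((k : ℝ) + 1 + j + 1) =
      ((k + 1 + j + 1).choose (k + 1) : ℕ) * ((j : ℝ) + 1) := by
    have := Nat.choose_mul_succ_eq (k + 1 + j) (k + 1)
    rw [show k + 1 + j + 1 - (k + 1) = j + 1 by omega] at this
    exact_mod_cast this
  have hkey : (((k + 1 + j : ℕ) : ℝ) + 1) * bern (k + 1 + j) (k + 1) t * (1 - t) =
      ((j : ℝ) + 1) * bern (k + 1 + j + 1) (k + 1) t := by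
    rw [bern_eq, bern_eq, show k + 1 + j - (k + 1) = j by omega,
      show k + 1 + j + 1 - (k + 1) = j + 1 by omega, pow_succ]
    push_cast
    linear_combination t ^ (k + 1) * (1 - t) ^ j * (1 - t) * hch
  calc _ = ((((k + 1 + j : ℕ) : ℝ) + 1) * bern (k + 1 + j) (k + 1) t * (1 - t)) *
        ((k : ℝ) + 1) := by ring
    _ = (((j : ℝ) + 1) * ((k : ℝ) + 1)) * bern (k + 1 + j + 1) (k + 1) t := by rw [hkey]; ring
    _ ≤ _ := by
        refine mul_le_mul_of_nonneg_right ?_ hb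
        push_cast
        nlinarith [j.cast_nonneg (α := ℝ), k.cast_nonneg (α := ℝ)]

/-! ### The bridge from an initial law to a point mass -/

/-- The mass at `k` at time `t` of a particle with initial law `ν` which makes `z + 1` jumps at
independent uniform times in `[0,1]`: the first jump is a reset to `0`, the others are forward
jumps, so that the particle is at `z` at time `1`. -/
def bridgeMass (ν : PMF ℕ) (z k : ℕ) (t : ℝ) : ℝ :=
  bern (z + 1) 0 t * mass ν k + bern (z + 1) (k + 1) t

/-- The time derivative of `bridgeMass`. -/
def bridgeVel (ν : PMF ℕ) (t : ℝ) (z k : ℕ) : ℝ :=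
  ((z : ℝ) + 1) * (bern z k t - bern z (k + 1) t - bern z 0 t * mass ν k)

lemma hasDerivAt_bridgeMass (ν : PMF ℕ) (z k : ℕ) (t : ℝ) :
    HasDerivAt (bridgeMass ν z k) (bridgeVel ν t z k) t := by
  have h := ((hasDerivAt_bern_zero z t).mul_const (mass ν k)).fun_add (hasDerivAt_bern_succ z k t)
  refine h.congr_deriv ?_
  unfold bridgeVel
  ring

lemma bridgeMass_nonneg (ν : PMF ℕ) (z k : ℕ) {t : ℝ} (ht : t ∈ Set.Icc (0 : ℝ) 1) :
    0 ≤ bridgeMass ν z k t :=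
  add_nonneg (mul_nonneg (bern_nonneg _ _ ht) (mass_nonneg _ _)) (bern_nonneg _ _ ht)

lemma hasSum_bern_succ (n : ℕ) (t : ℝ) : HasSum (fun k => bern n (k + 1) t) (1 - bern n 0 t) := by
  simpa using (hasSum_nat_add_iff' 1).2 (hasSum_bern n t)

lemma hasSum_bridgeMass (ν : PMF ℕ) (z : ℕ) (t : ℝ) :
    HasSum (fun k => bridgeMass ν z k t) 1 := by
  simpa [bridgeMass] using
    ((hasSum_mass ν).mul_left (bern (z + 1) 0 t)).add (hasSum_bern_succ (z + 1) t)

lemma abs_bridgeVel_le (ν : PMF ℕ) (z k : ℕ) {t : ℝ} (ht : t ∈ Set.Icc (0 : ℝ) 1) :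
    |bridgeVel ν t z k| ≤ 2 * ((z : ℝ) + 1) := by
  have h1 := bern_nonneg z k ht
  have h2 := bern_le_one z k ht
  have h3 := bern_nonneg z (k + 1) ht
  have h4 := bern_le_one z (k + 1) ht
  have h5 : 0 ≤ bern z 0 t * mass ν k := mul_nonneg (bern_nonneg z 0 ht) (mass_nonneg ν k)
  have h6 : bern z 0 t * mass ν k ≤ 1 :=
    mul_le_one₀ (bern_le_one z 0 ht) (mass_nonneg ν k) (mass_le_one ν k)
  unfold bridgeVel
  rw [abs_mul, abs_of_nonneg (by positivity : (0 : ℝ) ≤ (z : ℝ) + 1), mul_comm]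
  refine mul_le_mul_of_nonneg_right ?_ (by positivity)
  rw [abs_le]
  constructor <;> linarith

lemma abs_bridgeMass_sub_le (ν : PMF ℕ) (z k : ℕ) {s t : ℝ} (hs : s ∈ Set.Icc (0 : ℝ) 1)
    (ht : t ∈ Set.Icc (0 : ℝ) 1) :
    |bridgeMass ν z k s - bridgeMass ν z k t| ≤ 2 * ((z : ℝ) + 1) * |s - t| :=
  (convex_Icc (0 : ℝ) 1).norm_image_sub_le_of_norm_hasDerivWithin_le
    (fun x _ => (hasDerivAt_bridgeMass ν z k x).hasDerivWithinAt)
    (fun _ hx => abs_bridgeVel_le ν z k hx) ht hs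

lemma pairing_eq_tsum (α : ℕ →₀ ℝ) (v : ℕ → ℝ) : pairing α v = ∑' k, α k * v k := by
  rw [pairing_eq_sum subset_rfl, tsum_eq_sum]
  intro k hk
  rw [Finsupp.notMem_support_iff.1 hk, zero_mul]

lemma summable_finsupp_mul (α : ℕ →₀ ℝ) (v : ℕ → ℝ) : Summable fun k => α k * v k :=
  summable_of_ne_finset_zero (s := α.support) fun k hk => by
    rw [Finsupp.notMem_support_iff.1 hk, zero_mul]

/-- The velocity of the bridge is the divergence of the flux `(z+1) bern z (k+1)` along
`k → k + 1` and the flux `(z+1) bern z 0 ν(k)` along `k → 0`. -/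
lemma hasSum_pairing_bridgeVel (ν : PMF ℕ) (z : ℕ) (t : ℝ) (α : ℕ →₀ ℝ) :
    HasSum (fun k => ((z : ℝ) + 1) * bern z (k + 1) t * (α (k + 1) - α k) +
      ((z : ℝ) + 1) * bern z 0 t * mass ν k * (α 0 - α k)) (pairing α (bridgeVel ν t z)) := by
  have hA := (summable_finsupp_mul α fun k => bern z k t).hasSum
  have hA' := (hasSum_nat_add_iff' 1).2 hA
  rw [Finset.sum_range_one] at hA'
  have hB := (summable_finsupp_mul α fun k => bern z (k + 1) t).hasSum
  have hX := (summable_finsupp_mul α fun k => mass ν k).hasSum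
  have hp : HasSum (fun k => α k * bridgeVel ν t z k) (pairing α (bridgeVel ν t z)) := by
    rw [pairing_eq_tsum]
    exact (summable_finsupp_mul α _).hasSum
  have hp' := ((hA.sub hB).sub (hX.mul_left (bern z 0 t))).mul_left ((z : ℝ) + 1)
  have heq := hp.unique (hp'.congr_fun fun k => by unfold bridgeVel; ring)
  have h1 := ((hA'.sub hB).mul_left ((z : ℝ) + 1)).add
    ((((hasSum_mass ν).mul_left (α 0)).sub hX).mul_left (((z : ℝ) + 1) * bern z 0 t))
  rw [heq]
  convert! h1 using 1
  · funext k
    ring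
  · ring

/-- One half of the duality between `e^x` and the relative entropy of fluxes: a flux `r` at most
`e^L` times the flux `c` under the natural rates costs at most `L` per unit. -/
lemma mul_sub_mul_exp_le {r c L : ℝ} (hr : 0 ≤ r) (h : r ≤ c * Real.exp L) (x : ℝ) :
    r * x - c * Real.exp x ≤ r * L := by
  have h1 : r * Real.exp (x - L) ≤ c * Real.exp x := by
    calc r * Real.exp (x - L) ≤ c * Real.exp L * Real.exp (x - L) :=
          mul_le_mul_of_nonneg_right h (Real.exp_pos _).le
      _ = c * Real.exp x := by rw [mul_assoc, ← Real.exp_add]; congr 2; ring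
  have h2 : r * (x - L + 1) ≤ r * Real.exp (x - L) :=
    mul_le_mul_of_nonneg_left (Real.add_one_le_exp _) hr
  nlinarith

/-- The cost of a single bridge, under rates evaluated at an arbitrary law `ζ`. -/
lemma bridge_cost_le {lam : ℕ → ℕ → PMF ℕ → ℝ} {lo hi : ℝ} (h : HasRateBounds lam lo hi)
    (ν ζ : PMF ℕ) (z : ℕ) {t : ℝ} (ht : t ∈ Set.Ioo (0 : ℝ) 1) {L : ℝ} (hL0 : 0 ≤ L)
    (hL : ((z : ℝ) + 1) ^ 2 ≤ lo * Real.exp L * (1 - t)) (α : ℕ →₀ ℝ)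
    (hs : Summable fun k => bridgeMass ν z k t *
      (fwdRate lam ζ k * (Real.exp (α (k + 1) - α k) - 1) +
        resetRate lam ζ k * (Real.exp (α 0 - α k) - 1))) :
    pairing α (bridgeVel ν t z) - ∑' k, bridgeMass ν z k t *
      (fwdRate lam ζ k * (Real.exp (α (k + 1) - α k) - 1) +
        resetRate lam ζ k * (Real.exp (α 0 - α k) - 1)) ≤ ((z : ℝ) + 1) * L + 2 * hi := by
  have htc : t ∈ Set.Icc (0 : ℝ) 1 := Set.Ioo_subset_Icc_self ht
  have ht1 : 0 < 1 - t := sub_pos.2 ht.2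
  have hz : (0 : ℝ) < (z : ℝ) + 1 := by positivity
  have hlhs := (hasSum_pairing_bridgeVel ν z t α).sub hs.hasSum
  have hrhs := (((hasSum_bern_succ z t).mul_left (((z : ℝ) + 1) * L)).add
    ((hasSum_mass ν).mul_left (((z : ℝ) + 1) * bern z 0 t * L))).add
    ((hasSum_bridgeMass ν z t).mul_left (2 * hi))
  have hval : ((z : ℝ) + 1) * L * (1 - bern z 0 t) + ((z : ℝ) + 1) * bern z 0 t * L * 1 +
      2 * hi * 1 = ((z : ℝ) + 1) * L + 2 * hi := by ring
  rw [hval] at hrhs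
  refine hasSum_le (fun k => ?_) hlhs hrhs
  have hk : (0 : ℝ) < (k : ℝ) + 1 := by positivity
  have hb1 := bern_nonneg z (k + 1) htc
  have hb2 := bern_nonneg z 0 htc
  have hb3 := bern_nonneg (z + 1) (k + 1) htc
  have hb4 := bern_nonneg (z + 1) 0 htc
  have hν := mass_nonneg ν k
  have hf0 := h.fwd_nonneg ζ k
  have hr0 := h.reset_nonneg ζ k
  have hm := bridgeMass_nonneg ν z k htc
  have hexp := Real.exp_pos L
  have c1 : ((z : ℝ) + 1) * bern z (k + 1) t * (α (k + 1) - α k) -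
      bern (z + 1) (k + 1) t * fwdRate lam ζ k * Real.exp (α (k + 1) - α k) ≤
      ((z : ℝ) + 1) * bern z (k + 1) t * L := by
    refine mul_sub_mul_exp_le (by positivity) ?_ _
    have e1 : ((z : ℝ) + 1) * bern z (k + 1) t * ((1 - t) * ((k : ℝ) + 1)) ≤
        bern (z + 1) (k + 1) t * (lo / ((k : ℝ) + 1)) * Real.exp L *
          ((1 - t) * ((k : ℝ) + 1)) := by
      calc _ ≤ ((z : ℝ) + 1) ^ 2 * bern (z + 1) (k + 1) t := bern_flux_le z k htc
        _ ≤ lo * Real.exp L * (1 - t) * bern (z + 1) (k + 1) t :=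
          mul_le_mul_of_nonneg_right hL hb3
        _ = _ := by field_simp
    refine (le_of_mul_le_mul_right e1 (by positivity)).trans ?_
    have := h.le_fwd ζ k
    gcongr
  have c2 : ((z : ℝ) + 1) * bern z 0 t * mass ν k * (α 0 - α k) -
      bern (z + 1) 0 t * mass ν k * resetRate lam ζ k * Real.exp (α 0 - α k) ≤
      ((z : ℝ) + 1) * bern z 0 t * mass ν k * L := by
    rcases Nat.eq_zero_or_pos k with rfl | hkpos
    · -- No reset happens at `0`: the corresponding flux is spurious and pairs to zero.
      simp only [resetRate, if_true, sub_self, mul_zero, zero_mul]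
      positivity
    refine mul_sub_mul_exp_le (by positivity) ?_ _
    have hlo : lo ≤ resetRate lam ζ k := h.le_reset ζ k hkpos.ne'
    have e1 : (z : ℝ) + 1 ≤ lo * Real.exp L * (1 - t) := le_trans (by nlinarith) hL
    have e2 : (z : ℝ) + 1 ≤ resetRate lam ζ k * Real.exp L * (1 - t) := e1.trans (by gcongr)
    rw [bern_succ_zero]
    calc _ = ((z : ℝ) + 1) * (bern z 0 t * mass ν k) := by ring
      _ ≤ resetRate lam ζ k * Real.exp L * (1 - t) * (bern z 0 t * mass ν k) :=
        mul_le_mul_of_nonneg_right e2 (by positivity)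
      _ = _ := by ring
  have d1 : bern (z + 1) (k + 1) t * fwdRate lam ζ k * Real.exp (α (k + 1) - α k) ≤
      bridgeMass ν z k t * fwdRate lam ζ k * Real.exp (α (k + 1) - α k) := by
    have : bern (z + 1) (k + 1) t ≤ bridgeMass ν z k t := le_add_of_nonneg_left (by positivity)
    gcongr
  have d2 : bern (z + 1) 0 t * mass ν k * resetRate lam ζ k * Real.exp (α 0 - α k) ≤
      bridgeMass ν z k t * resetRate lam ζ k * Real.exp (α 0 - α k) := by
    have : bern (z + 1) 0 t * mass ν k ≤ bridgeMass ν z k t := le_add_of_nonneg_right hb3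
    gcongr
  have d3 : bridgeMass ν z k t * (fwdRate lam ζ k + resetRate lam ζ k) ≤
      bridgeMass ν z k t * (2 * hi) :=
    mul_le_mul_of_nonneg_left (by linarith [h.fwd_le_hi ζ k, h.reset_le ζ k]) hm
  linarith

/-! ### Mixing the bridges over the target law -/

/-- The law at time `t` of the bridge to `z` started from `ν`; times outside `[0,1]` are projected
onto `[0,1]`. -/
def bridge (ν : PMF ℕ) (t : ℝ) (z : ℕ) : PMF ℕ :=
  ⟨fun k => ENNReal.ofReal (bridgeMass ν z k (Set.projIcc (0 : ℝ) 1 zero_le_one t)), by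
    have hn : ∀ k, 0 ≤ bridgeMass ν z k (Set.projIcc (0 : ℝ) 1 zero_le_one t) := fun k =>
      bridgeMass_nonneg ν z k (Subtype.property _)
    have hs := hasSum_bridgeMass ν z (Set.projIcc (0 : ℝ) 1 zero_le_one t)
    rw [ENNReal.summable.hasSum_iff, ← ENNReal.ofReal_tsum_of_nonneg hn hs.summable, hs.tsum_eq,
      ENNReal.ofReal_one]⟩

lemma mass_bridge (ν : PMF ℕ) (z k : ℕ) {t : ℝ} (ht : t ∈ Set.Icc (0 : ℝ) 1) :
    mass (bridge ν t z) k = bridgeMass ν z k t := by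
  change (ENNReal.ofReal (bridgeMass ν z k (Set.projIcc (0 : ℝ) 1 zero_le_one t))).toReal = _
  rw [Set.projIcc_of_mem zero_le_one ht, ENNReal.toReal_ofReal (bridgeMass_nonneg ν z k ht)]

lemma mass_bind (ξ : PMF ℕ) (f : ℕ → PMF ℕ) (k : ℕ) :
    mass (ξ.bind f) k = ∑' z, mass ξ z * mass (f z) k := by
  rw [mass, PMF.bind_apply, ENNReal.tsum_toReal_eq
    fun z => ENNReal.mul_ne_top (ξ.apply_ne_top z) ((f z).apply_ne_top k)]
  simp [mass, ENNReal.toReal_mul]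

lemma abs_tsum_mass_mul_le (ξ : PMF ℕ) {g : ℕ → ℝ} {C : ℝ} (hg : ∀ z, |g z| ≤ C) :
    |∑' z, mass ξ z * g z| ≤ C := by
  have h := (hasSum_mass ξ).mul_right C
  rw [one_mul] at h
  rw [← Real.norm_eq_abs]
  refine tsum_of_norm_bounded h fun z => ?_
  rw [Real.norm_eq_abs, abs_mul, abs_of_nonneg (mass_nonneg ξ z)]
  exact mul_le_mul_of_nonneg_left (hg z) (mass_nonneg ξ z)

lemma tsum_mass_bind_mul (ξ : PMF ℕ) (f : ℕ → PMF ℕ) {g : ℕ → ℝ} {C : ℝ} (hg : ∀ k, |g k| ≤ C) :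
    ∑' k, mass (ξ.bind f) k * g k = ∑' z, mass ξ z * ∑' k, mass (f z) k * g k := by
  have hbase : Summable fun p : ℕ × ℕ => mass ξ p.1 * mass (f p.1) p.2 := by
    have hz : ∀ z, ∑' k, mass ξ z * mass (f z) k = mass ξ z := fun z => by
      rw [tsum_mul_left, (hasSum_mass (f z)).tsum_eq, mul_one]
    have hn : (0 : ℕ × ℕ → ℝ) ≤ fun p => mass ξ p.1 * mass (f p.1) p.2 := by
      intro p
      exact mul_nonneg (mass_nonneg ξ p.1) (mass_nonneg (f p.1) p.2)
    have hsec : ∀ z, Summable fun k => mass ξ z * mass (f z) k := fun z =>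
      (hasSum_mass (f z)).summable.mul_left (mass ξ z)
    refine (summable_prod_of_nonneg hn).2 ⟨hsec, ?_⟩
    simpa only [hz] using (hasSum_mass ξ).summable
  have hsum : Summable (Function.uncurry fun z k => mass ξ z * (mass (f z) k * g k)) := by
    refine Summable.of_norm_bounded (hbase.mul_right C) fun p => ?_
    have hn : 0 ≤ mass ξ p.1 * mass (f p.1) p.2 :=
      mul_nonneg (mass_nonneg ξ p.1) (mass_nonneg (f p.1) p.2)
    rw [Function.uncurry, ← mul_assoc, Real.norm_eq_abs, abs_mul, abs_of_nonneg hn]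
    exact mul_le_mul_of_nonneg_left (hg _) hn
  simp only [mass_bind, ← tsum_mul_right, ← tsum_mul_left, mul_assoc]
  exact hsum.tsum_comm

lemma summable_mass_mul_vartheta {ξ : PMF ℕ} (h : thetaMoment ξ < ⊤) :
    Summable fun z => mass ξ z * vartheta z := by
  have := ENNReal.summable_toReal h.ne
  simpa only [ENNReal.toReal_mul, ENNReal.toReal_ofReal (vartheta_nonneg _), mass] using this

lemma tsum_mass_mul_vartheta (ξ : PMF ℕ) :
    ∑' z, mass ξ z * vartheta z = (thetaMoment ξ).toReal := by
  rw [thetaMoment, ENNReal.tsum_toReal_eq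
    fun z => ENNReal.mul_ne_top (ξ.apply_ne_top z) ENNReal.ofReal_ne_top]
  simp only [ENNReal.toReal_mul, ENNReal.toReal_ofReal (vartheta_nonneg _), mass]

lemma summable_mass_mul_four_add {ξ : PMF ℕ} (h : thetaMoment ξ < ⊤) :
    Summable fun z => mass ξ z * (4 + vartheta z) := by
  simp only [mul_add]
  exact ((hasSum_mass ξ).summable.mul_right 4).add (summable_mass_mul_vartheta h)

lemma summable_mass_mul_two {ξ : PMF ℕ} (h : thetaMoment ξ < ⊤) :
    Summable fun z => mass ξ z * (2 * ((z : ℝ) + 1)) := by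
  refine Summable.of_nonneg_of_le (fun z => mul_nonneg (mass_nonneg ξ z) (by positivity))
    (fun z => ?_) ((summable_mass_mul_four_add h).mul_left 2)
  have := mul_le_mul_of_nonneg_left (add_one_le_vartheta z) (mass_nonneg ξ z)
  linarith

/-- The path from `ν` to `ξ`: a mixture of bridges whose targets are distributed as `ξ`. -/
def bridgePath (ν ξ : PMF ℕ) (t : ℝ) : PMF ℕ := ξ.bind (bridge ν t)

lemma mass_bridgePath (ν ξ : PMF ℕ) (k : ℕ) {t : ℝ} (ht : t ∈ Set.Icc (0 : ℝ) 1) :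
    mass (bridgePath ν ξ t) k = ∑' z, mass ξ z * bridgeMass ν z k t := by
  rw [bridgePath, mass_bind]
  simp only [mass_bridge _ _ _ ht]

lemma pmf_ext_mass {ξ ζ : PMF ℕ} (h : ∀ k, mass ξ k = mass ζ k) : ξ = ζ :=
  PMF.ext fun k => (ENNReal.toReal_eq_toReal_iff' (ξ.apply_ne_top k) (ζ.apply_ne_top k)).1 (h k)

lemma bridgePath_zero (ν ξ : PMF ℕ) : bridgePath ν ξ 0 = ν := by
  refine pmf_ext_mass fun k => ?_
  rw [mass_bridgePath ν ξ k (by simp)]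
  simp [bridgeMass, bern_eq, tsum_mul_right, (hasSum_mass ξ).tsum_eq]

lemma bridgePath_one (ν ξ : PMF ℕ) : bridgePath ν ξ 1 = ξ := by
  refine pmf_ext_mass fun k => ?_
  rw [mass_bridgePath ν ξ k (by simp), tsum_eq_single k]
  · simp [bridgeMass, bern_eq]
  · intro z hz
    have : ¬ k = z := fun h => hz h.symm
    simp [bridgeMass, bern, bernsteinPolynomial.eval_at_1, this]

lemma summable_mass_mul_bridgeMass (ν ξ : PMF ℕ) (k : ℕ) {t : ℝ} (ht : t ∈ Set.Icc (0 : ℝ) 1) :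
    Summable fun z => mass ξ z * bridgeMass ν z k t :=
  summable_mass_mul (C := 1) ξ fun z => by
    rw [abs_of_nonneg (bridgeMass_nonneg ν z k ht)]
    exact le_hasSum (hasSum_bridgeMass ν z t) k fun j _ => bridgeMass_nonneg ν z j ht

lemma hasDerivAt_mass_bridgePath (ν : PMF ℕ) {ξ : PMF ℕ} (h : thetaMoment ξ < ⊤) (k : ℕ) {t : ℝ}
    (ht : t ∈ Set.Ioo (0 : ℝ) 1) :
    HasDerivAt (fun s => mass (bridgePath ν ξ s) k) (∑' z, mass ξ z * bridgeVel ν t z k) t := by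
  have hd := hasDerivAt_tsum_of_isPreconnected (summable_mass_mul_two h) isOpen_Ioo
    isPreconnected_Ioo (fun z s _ => (hasDerivAt_bridgeMass ν z k s).const_mul (mass ξ z))
    (fun z s hs => by
      rw [Real.norm_eq_abs, abs_mul, abs_of_nonneg (mass_nonneg ξ z)]
      exact mul_le_mul_of_nonneg_left (abs_bridgeVel_le ν z k (Set.Ioo_subset_Icc_self hs))
        (mass_nonneg ξ z)) ht
    (summable_mass_mul_bridgeMass ν ξ k (Set.Ioo_subset_Icc_self ht)) ht
  refine hd.congr_of_eventuallyEq ?_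
  filter_upwards [isOpen_Ioo.mem_nhds ht] with s hs
  exact mass_bridgePath ν ξ k (Set.Ioo_subset_Icc_self hs)

lemma abs_mass_bridgePath_sub_le (ν : PMF ℕ) {ξ : PMF ℕ} (h : thetaMoment ξ < ⊤) (k : ℕ) {s t : ℝ}
    (hs : s ∈ Set.Icc (0 : ℝ) 1) (ht : t ∈ Set.Icc (0 : ℝ) 1) :
    |mass (bridgePath ν ξ s) k - mass (bridgePath ν ξ t) k| ≤
      (∑' z, mass ξ z * (2 * ((z : ℝ) + 1))) * |s - t| := by
  rw [mass_bridgePath ν ξ k hs, mass_bridgePath ν ξ k ht,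
    ← (summable_mass_mul_bridgeMass ν ξ k hs).tsum_sub (summable_mass_mul_bridgeMass ν ξ k ht)]
  rw [← Real.norm_eq_abs]
  refine tsum_of_norm_bounded ((summable_mass_mul_two h).hasSum.mul_right |s - t|) fun z => ?_
  rw [← mul_sub, Real.norm_eq_abs, abs_mul, abs_of_nonneg (mass_nonneg ξ z), mul_assoc]
  exact mul_le_mul_of_nonneg_left (abs_bridgeMass_sub_le ν z k hs ht) (mass_nonneg ξ z)

lemma isAbsolutelyContinuousPath_bridgePath (ν : PMF ℕ) {ξ : PMF ℕ} (h : thetaMoment ξ < ⊤) :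
    IsAbsolutelyContinuousPath 1 (bridgePath ν ξ) := by
  intro K
  set C := ∑' z, mass ξ z * (2 * ((z : ℝ) + 1))
  refine ⟨1, one_pos, fun s => (K.card * C) * s,
    (by fun_prop : ContDiffOn ℝ 1 (fun s => (K.card * C) * s) _).absolutelyContinuousOnInterval,
    fun f hf hf1 s hs t ht => ?_⟩
  rw [pairing_eq_sum hf, pairing_eq_sum hf, ← Finset.sum_sub_distrib, ← mul_sub, abs_mul]
  have hK : ∑ _z ∈ K, C * |s - t| = K.card * C * |s - t| := by
    rw [Finset.sum_const, nsmul_eq_mul, mul_assoc]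
  calc _ ≤ ∑ z ∈ K, |f z * mass (bridgePath ν ξ s) z - f z * mass (bridgePath ν ξ t) z| :=
        Finset.abs_sum_le_sum_abs _ _
    _ ≤ ∑ _z ∈ K, C * |s - t| := by
        refine Finset.sum_le_sum fun z _ => ?_
        rw [← mul_sub, abs_mul]
        exact (mul_le_of_le_one_left (abs_nonneg _) (hf1 z).le).trans
          (abs_mass_bridgePath_sub_le ν h z hs ht)
    _ = K.card * C * |s - t| := hK
    _ ≤ |K.card * C| * |s - t| := mul_le_mul_of_nonneg_right (le_abs_self _) (abs_nonneg _)

/-! ### A finite moment gives finite cost -/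

lemma pairing_bridgePath_vel (ν : PMF ℕ) {ξ : PMF ℕ} (h : thetaMoment ξ < ⊤) {t : ℝ}
    (ht : t ∈ Set.Icc (0 : ℝ) 1) (α : ℕ →₀ ℝ) :
    HasSum (fun z => mass ξ z * pairing α (bridgeVel ν t z))
      (pairing α fun k => ∑' z, mass ξ z * bridgeVel ν t z k) := by
  have hk : ∀ k, HasSum (fun z => mass ξ z * bridgeVel ν t z k)
      (∑' z, mass ξ z * bridgeVel ν t z k) := fun k => by
    refine (Summable.of_norm_bounded (summable_mass_mul_two h) fun z => ?_).hasSum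
    rw [Real.norm_eq_abs, abs_mul, abs_of_nonneg (mass_nonneg ξ z)]
    exact mul_le_mul_of_nonneg_left (abs_bridgeVel_le ν z k ht) (mass_nonneg ξ z)
  have := hasSum_sum fun k (_ : k ∈ α.support) => (hk k).mul_left (α k)
  convert! this using 1
  funext z
  rw [pairing, Finsupp.sum, Finset.mul_sum]
  exact Finset.sum_congr rfl fun k _ => by ring

/-- The exponent `L` of `bridge_cost_le` can be chosen logarithmic in `z` and in `1 - t`; summed
against the number `z + 1` of jumps, it is controlled by `ϑ`. -/
lemma exists_bridge_exponent {lo : ℝ} (hlo : 0 < lo) (z : ℕ) {t : ℝ}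
    (ht : t ∈ Set.Ioo (0 : ℝ) 1) :
    ∃ L, 0 ≤ L ∧ ((z : ℝ) + 1) ^ 2 ≤ lo * Real.exp L * (1 - t) ∧
      ((z : ℝ) + 1) * L ≤ (4 + vartheta z) * (4 - Real.log (min lo 1) - Real.log (1 - t)) := by
  have ht1 : 0 < 1 - t := sub_pos.2 ht.2
  have hm : 0 < min lo 1 := lt_min hlo one_pos
  have hz : (0 : ℝ) < (z : ℝ) + 1 := by positivity
  have l1 : 0 ≤ Real.log ((z : ℝ) + 1) := Real.log_nonneg (by linarith [z.cast_nonneg (α := ℝ)])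
  have l2 : Real.log (min lo 1) ≤ 0 := Real.log_nonpos hm.le (min_le_right _ _)
  have l3 : Real.log (1 - t) ≤ 0 := Real.log_nonpos ht1.le (by linarith [ht.1])
  refine ⟨2 * Real.log ((z : ℝ) + 1) - Real.log (min lo 1) - Real.log (1 - t), by linarith,
    ?_, ?_⟩
  · have he : Real.exp (2 * Real.log ((z : ℝ) + 1) - Real.log (min lo 1) - Real.log (1 - t)) =
        ((z : ℝ) + 1) ^ 2 / min lo 1 / (1 - t) := by
      rw [Real.exp_sub, Real.exp_sub, Real.exp_log hm, Real.exp_log ht1, two_mul, Real.exp_add,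
        Real.exp_log hz, sq]
    rw [he]
    have : lo * (((z : ℝ) + 1) ^ 2 / min lo 1 / (1 - t)) * (1 - t) =
        lo / min lo 1 * ((z : ℝ) + 1) ^ 2 := by field_simp
    rw [this]
    exact le_mul_of_one_le_left (by positivity) ((one_le_div hm).2 (min_le_left _ _))
  · have h1 := add_one_le_vartheta z
    have h2 := add_one_mul_log_le_vartheta z
    have h3 := mul_le_mul_of_nonneg_right h1
      (by linarith : 0 ≤ - Real.log (min lo 1) - Real.log (1 - t))
    linarith [vartheta_nonneg z]

lemma localCost_bridgePath_le {lam : ℕ → ℕ → PMF ℕ → ℝ} {lo hi : ℝ} (h : HasRateBounds lam lo hi)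
    (ν : PMF ℕ) {ξ : PMF ℕ} (hξ : thetaMoment ξ < ⊤) {t : ℝ} (ht : t ∈ Set.Ioo (0 : ℝ) 1) :
    localCost forwardResetEdges lam (bridgePath ν ξ t)
      (fun k => deriv (fun s => mass (bridgePath ν ξ s) k) t) ≤
      ENNReal.ofReal ((4 + (thetaMoment ξ).toReal) *
        (4 - Real.log (min lo 1) - Real.log (1 - t)) + 2 * hi) := by
  have htc : t ∈ Set.Icc (0 : ℝ) 1 := Set.Ioo_subset_Icc_self ht
  refine iSup_le fun α => ENNReal.ofReal_le_ofReal ?_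
  simp only [(hasDerivAt_mass_bridgePath ν hξ _ ht).deriv]
  set ζ := bridgePath ν ξ t with hζ
  rw [costFunctional_forwardReset (h.abs_fwd_le ζ) (h.abs_reset_le ζ)]
  set g : ℕ → ℝ := fun k => fwdRate lam ζ k * (Real.exp (α (k + 1) - α k) - 1) +
    resetRate lam ζ k * (Real.exp (α 0 - α k) - 1) with hg
  obtain ⟨A, hA, hαA⟩ := exists_abs_le α
  have hexp : ∀ k w, |Real.exp (α w - α k) - 1| ≤ Real.exp (2 * A) + 1 := fun k w => by
    have h1 : Real.exp (α w - α k) ≤ Real.exp (2 * A) :=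
      Real.exp_le_exp.2 (by linarith [(abs_le.1 (hαA w)).2, (abs_le.1 (hαA k)).1])
    rw [abs_le]
    constructor <;> linarith [Real.exp_pos (α w - α k), Real.exp_pos (2 * A)]
  have hgC : ∀ k, |g k| ≤ hi * (Real.exp (2 * A) + 1) + hi * (Real.exp (2 * A) + 1) := fun k => by
    refine (abs_add_le _ _).trans ?_
    rw [abs_mul, abs_mul]
    exact add_le_add
      (mul_le_mul (h.abs_fwd_le ζ k) (hexp _ _) (abs_nonneg _) h.hi_pos.le)
      (mul_le_mul (h.abs_reset_le ζ k) (hexp _ _) (abs_nonneg _) h.hi_pos.le)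
  have hS : HasSum (fun z => mass ξ z * ∑' k, mass (bridge ν t z) k * g k)
      (∑' k, mass ζ k * g k) := by
    rw [hζ, bridgePath, tsum_mass_bind_mul ξ _ hgC]
    exact (summable_mass_mul ξ fun z => abs_tsum_mass_mul_le _ hgC).hasSum
  have hlhs := (pairing_bridgePath_vel ν hξ htc α).sub hS
  have hΘ : HasSum (fun z => mass ξ z * (4 + vartheta z)) (4 + (thetaMoment ξ).toReal) := by
    have := ((hasSum_mass ξ).mul_right 4).add (summable_mass_mul_vartheta hξ).hasSum
    rw [tsum_mass_mul_vartheta, one_mul] at this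
    simpa only [mul_add] using this
  have hrhs := (hΘ.mul_right (4 - Real.log (min lo 1) - Real.log (1 - t))).add
    ((hasSum_mass ξ).mul_right (2 * hi))
  rw [one_mul] at hrhs
  refine hasSum_le (fun z => ?_) hlhs hrhs
  obtain ⟨L, hL0, hL, hLz⟩ := exists_bridge_exponent h.lo_pos z ht
  have hs : Summable fun k => bridgeMass ν z k t * g k := by
    simpa only [mass_bridge _ _ _ htc] using summable_mass_mul (bridge ν t z) hgC
  have hcost := bridge_cost_le h ν ζ z ht hL0 hL α hs
  simp only [mass_bridge _ _ _ htc]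
  have := mul_le_mul_of_nonneg_left (hcost.trans (add_le_add_left hLz (2 * hi)))
    (mass_nonneg ξ z)
  linarith

/-- `∫₀¹ -log(1-t) dt = 1`, so the singularity of the bridges at the final time is integrable. -/
lemma setLIntegral_sub_log_eq {a A b : ℝ} (ha : 0 ≤ a) (hA : 0 ≤ A) (hb : 0 ≤ b) :
    ∫⁻ t in Set.Ioo (0 : ℝ) 1, ENNReal.ofReal (a * (A - Real.log (1 - t)) + b) =
      ENNReal.ofReal (a * (A + 1) + b) := by
  have hlog : IntervalIntegrable (fun t => Real.log (1 - t)) volume 0 1 := by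
    have := (intervalIntegral.intervalIntegrable_log' (a := 0) (b := 1)).comp_sub_left 1
    simpa using this.symm
  have hint : IntervalIntegrable (fun t => a * (A - Real.log (1 - t)) + b) volume 0 1 :=
    ((intervalIntegrable_const.sub hlog).const_mul a).add intervalIntegrable_const
  have hval : ∫ t in (0 : ℝ)..1, (a * (A - Real.log (1 - t)) + b) = a * (A + 1) + b := by
    rw [intervalIntegral.integral_add ((intervalIntegrable_const.sub hlog).const_mul a)
      intervalIntegrable_const, intervalIntegral.integral_const_mul,
      intervalIntegral.integral_sub intervalIntegrable_const hlog,
      intervalIntegral.integral_comp_sub_left (fun x => Real.log x) 1]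
    simp
  have hIoo : IntegrableOn (fun t => a * (A - Real.log (1 - t)) + b) (Set.Ioo 0 1) :=
    ((intervalIntegrable_iff_integrableOn_Ioc_of_le zero_le_one).1 hint).mono_set
      Set.Ioo_subset_Ioc_self
  rw [← ofReal_integral_eq_lintegral_ofReal hIoo, ← integral_Ioc_eq_integral_Ioo,
    ← intervalIntegral.integral_of_le zero_le_one, hval]
  rw [EventuallyLE, ae_restrict_iff' measurableSet_Ioo]
  refine ae_of_all _ fun t ht => ?_
  have : Real.log (1 - t) ≤ 0 := Real.log_nonpos (by linarith [ht.2]) (by linarith [ht.1])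
  have : 0 ≤ A - Real.log (1 - t) := by linarith
  exact add_nonneg (mul_nonneg ha this) hb

lemma quasipotential_le {lam : ℕ → ℕ → PMF ℕ → ℝ} {lo hi : ℝ} (h : HasRateBounds lam lo hi)
    (ν : PMF ℕ) {ξ : PMF ℕ} (hξ : thetaMoment ξ < ⊤) :
    quasipotential forwardResetEdges lam ν ξ ≤
      ENNReal.ofReal ((4 + (thetaMoment ξ).toReal) * (4 - Real.log (min lo 1) + 1) + 2 * hi) := by
  have hm : Real.log (min lo 1) ≤ 0 :=
    Real.log_nonpos (lt_min h.lo_pos one_pos).le (min_le_right _ _)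
  have hinf : quasipotential forwardResetEdges lam ν ξ ≤
      pathCost forwardResetEdges lam 1 (bridgePath ν ξ) ν :=
    (iInf₂_le (1 : ℝ) one_pos).trans ((iInf_le _ (bridgePath ν ξ)).trans
      (iInf₂_le (bridgePath_zero ν ξ) (bridgePath_one ν ξ)))
  refine hinf.trans ?_
  rw [pathCost, if_pos ⟨bridgePath_zero ν ξ, isAbsolutelyContinuousPath_bridgePath ν hξ⟩,
    ← setLIntegral_sub_log_eq (by positivity) (by linarith) (by linarith [h.hi_pos]),
    ← setLIntegral_congr Ioo_ae_eq_Icc]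
  exact setLIntegral_mono' measurableSet_Ioo fun t ht => localCost_bridgePath_le h ν hξ ht

end MeanField

end

theorem mainTheorem5 (E : Set (ℕ × ℕ)) (lam : ℕ → ℕ → PMF ℕ → ℝ) (ξstar : PMF ℕ)
    (hE : E = MeanField.forwardResetEdges)
    (hBounds : MeanField.RateBounds lam)
    (hLip : MeanField.RateLipschitz lam)
    (hStable : MeanField.IsGloballyAsymptoticallyStable E lam ξstar)
    (hMoment : MeanField.ThetaMomentConvergence E lam ξstar) :
    (∀ ξ : PMF ℕ, MeanField.quasipotential E lam ξstar ξ < ⊤ ↔ ξ ∈ MeanField.KSet) ∧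
    (∀ M : ℝ, 0 < M → ∃ C : ℝ, 0 < C ∧ ∀ ξ ∈ MeanField.KBall M,
      MeanField.quasipotential E lam ξstar ξ ≤ ENNReal.ofReal C) := by
  subst hE
  obtain ⟨lo, hi, h⟩ := hBounds.exists_hasRateBounds
  have hm : Real.log (min lo 1) ≤ 0 :=
    Real.log_nonpos (lt_min h.lo_pos one_pos).le (min_le_right _ _)
  refine ⟨fun ξ => ⟨MeanField.mem_KSet_of_quasipotential_lt_top h hMoment.1, fun hξ => ?_⟩,
    fun M hM => ?_⟩
  · exact (MeanField.quasipotential_le h ξstar (MeanField.mem_KSet_iff.1 hξ)).trans_lt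
      ENNReal.ofReal_lt_top
  · refine ⟨(4 + M) * (4 - Real.log (min lo 1) + 1) + 2 * hi, ?_, fun ξ hξ => ?_⟩
    · have := h.hi_pos
      have : 0 ≤ (4 + M) * (4 - Real.log (min lo 1) + 1) :=
        mul_nonneg (by linarith) (by linarith)
      linarith
    · have hξM : MeanField.thetaMoment ξ ≤ ENNReal.ofReal M := hξ
      refine (MeanField.quasipotential_le h ξstar (hξM.trans_lt ENNReal.ofReal_lt_top)).trans
        (ENNReal.ofReal_le_ofReal ?_)
      have hΘ : (MeanField.thetaMoment ξ).toReal ≤ M := ENNReal.toReal_le_of_le_ofReal hM.le hξM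
      have := mul_le_mul_of_nonneg_right (add_le_add_right hΘ 4)
        (by linarith : 0 ≤ 4 - Real.log (min lo 1) + 1)
      linarith
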